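/- A family of promise decision problems is a sequence of pairs $(L_n^{(+)},L_n^{(-)})_{n\in\mathbb N}$ of disjoint sets of strings over one alphabet $\Sigma$ (finite, nonempty, not depending on $n$). All automata below are two-way (head moves in $\{-1,0,+1\}$), have a finite set of inner states and sets of accepting and rejecting (halting) states that are disjoint, and read an input $x$ on a circular read-only tape of $|x|+2$ cells holding $x$ between a left and a right endmarker. Polynomials have nonnegative integer coefficients. A 2dfa accepts (rejects) $x$ if its computation ends in an accepting (rejecting) state; a 2nfa accepts $x$ if some computation path ends in an accepting state, and rejects $x$ if none does. A 2pfa is a probabilistic automaton with arbitrary real transition probabilities. A 2qfa is a measure-many quantum automaton with arbitrary complex amplitudes and a write-once garbage tape over a garbage alphabet $\Xi$: a transition of amplitude $\delta(q,\sigma\,|\,p,d,\xi)$ leads from state $q$, scanning $\sigma$, to state $p$, moves the head by $d$, and appends $\xi\in\Xi\cup\{\lambda\}$ to the garbage tape; the induced time evolution $U^{(x)}$ on the space spanned by the surface configurations (state, head position, garbage string) must be isometric, $(U^{(x)})^\dagger U^{(x)}=I$, for every $x\in\Sigma^*$; after each application of $U^{(x)}$ it is measured whether the state is accepting, rejecting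 or non-halting. For 2pfa's and 2qfa's, $p_{acc}(x)$ and $p_{rej}(x)$ are the total probabilities of ever accepting and ever rejecting $x$; there is no bound on the running time. A family $(M_n)$ of 2pfa's or 2qfa's solves $(L_n^{(+)},L_n^{(-)})_n$ with bounded error if there is a constant $\varepsilon\in[0,1/2)$ such that, for all $n$, $p_{acc,M_n}(x)\ge 1-\varepsilon$ for $x\in L_n^{(+)}$ and $p_{rej,M_n}(x)\ge 1-\varepsilon$ for $x\in L_n^{(-)}$; it does so with unbounded error if, for all $n$, $p_{acc,M_n}(x)>1/2$ for $x\in L_n^{(+)}$ and $p_{rej,M_n}(x)\ge 1/2$ for $x\in L_n^{(-)}$. Let $2\mathrm D$ (respectively $2\mathrm N$) be the class of all families $(L_n^{(+)},L_n^{(-)})_n$ for which there are a polynomial $p$ and 2dfa's (respectively 2nfa's) $M_n$ with at most $p(n)$ states such that, for all $n$, $M_n$ accepts every $x\in L_n^{(+)}$ and rejects every $x\in L_n^{(-)}$. Let $2\mathrm{BP}$ and $2\mathrm P$ be the classes of all families solved with bounded, respectively unbounded, error by 2pfa's $M_n$ with at most $p(n)$ states for some polynomial $p$. Let $2\mathrm{BQ}$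 and $2\mathrm Q$ be the classes of all families solved with bounded, respectively unbounded, error by 2qfa's $M_n$ with at most $p(n)$ states and at most $r(n)$ garbage symbols for some polynomials $p,r$. Then: 1. $2\mathrm D\subsetneqq 2\mathrm{BP}$, and moreover $2\mathrm{BP}\nsubseteq 2\mathrm N$; 2. $2\mathrm{BP}\subseteq 2\mathrm{BQ}$; 3. $2\mathrm{BQ}\subseteq 2\mathrm Q$; 4. $2\mathrm N\subseteq 2\mathrm P$; 5. $2\mathrm P\subseteq 2\mathrm Q$. -/

import Mathlib

open scoped ENNReal

/-! ### Input tapes -/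

/-- The symbols that can be scanned on an input tape: the letters of the alphabet and the left and
right endmarkers. -/
inductive TapeSymbol (A : Type) : Type
  | leftEnd : TapeSymbol A
  | letter : A → TapeSymbol A
  | rightEnd : TapeSymbol A

/-- A cell of the circular tape that holds `x` between the two endmarkers. It has `|x| + 2` cells,
and head moves are computed modulo `|x| + 2`. -/
abbrev Cell {A : Type} (x : List A) : Type := ZMod (x.length + 2)

/-- The symbol in cell `i`: the left endmarker in cell `0`, the letters of `x` in the cells
`1, …, |x|`, and the right endmarker in cell `|x| + 1`. -/
def tapeAt {A : Type} (x : List A) (i : Cell x) : TapeSymbol A :=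
  if i.val = 0 then .leftEnd
  else match x[i.val - 1]? with
    | some a => .letter a
    | none => .rightEnd

/-- The head move `d ∈ {-1, 0, +1}`, applied at cell `i` of the circular tape. -/
def moveHead {A : Type} {x : List A} (i : Cell x) (d : SignType) : Cell x :=
  i + (d : ZMod (x.length + 2))

/-! ### Families of promise decision problems -/

/-- A family of promise decision problems `(L n⁺, L n⁻)`, indexed by `n : ℕ`, over one alphabet
(a finite nonempty set) that does not depend on `n`. -/
structure PromiseFamily : Type 1 where
  Alphabet : Type
  [finite_alphabet : Finite Alphabet]
  [nonempty_alphabet : Nonempty Alphabet]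
  pos : ℕ → Set (List Alphabet)
  neg : ℕ → Set (List Alphabet)
  disjoint : ∀ n, Disjoint (pos n) (neg n)

/-! ### Two-way deterministic finite automata -/

/-- A two-way deterministic finite automaton (2dfa). -/
structure TwoDFA (A : Type) : Type 1 where
  State : Type
  [fintypeState : Fintype State]
  δ : State → TapeSymbol A → State × SignType
  start : State
  acc : Set State
  rej : Set State
  disjoint : Disjoint acc rej

attribute [instance] TwoDFA.fintypeState

namespace TwoDFA

variable {A : Type} (M : TwoDFA A)

/-- One computation step; there is none from a configuration with a halting state. -/
def Step (x : List A) (c c' : M.State × Cell x) : Prop :=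
  c.1 ∉ M.acc ∪ M.rej ∧
    c' = ((M.δ c.1 (tapeAt x c.2)).1, moveHead c.2 (M.δ c.1 (tapeAt x c.2)).2)

/-- The computation on `x` ends in an accepting state. -/
def Accepts (x : List A) : Prop :=
  ∃ c, Relation.ReflTransGen (M.Step x) (M.start, 0) c ∧ c.1 ∈ M.acc

/-- The computation on `x` ends in a rejecting state. -/
def Rejects (x : List A) : Prop :=
  ∃ c, Relation.ReflTransGen (M.Step x) (M.start, 0) c ∧ c.1 ∈ M.rej

end TwoDFA

/-! ### Two-way nondeterministic finite automata -/

/-- A two-way nondeterministic finite automaton (2nfa). -/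
structure TwoNFA (A : Type) : Type 1 where
  State : Type
  [fintypeState : Fintype State]
  δ : State → TapeSymbol A → Set (State × SignType)
  start : State
  acc : Set State
  rej : Set State
  disjoint : Disjoint acc rej

attribute [instance] TwoNFA.fintypeState

namespace TwoNFA

variable {A : Type} (M : TwoNFA A)

/-- One possible computation step; there is none from a configuration with a halting state. -/
def Step (x : List A) (c c' : M.State × Cell x) : Prop :=
  c.1 ∉ M.acc ∪ M.rej ∧
    ∃ pd ∈ M.δ c.1 (tapeAt x c.2), c' = (pd.1, moveHead c.2 pd.2)

/-- Some computation path on `x` ends in an accepting state. -/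
def Accepts (x : List A) : Prop :=
  ∃ c, Relation.ReflTransGen (M.Step x) (M.start, 0) c ∧ c.1 ∈ M.acc

/-- No computation path on `x` ends in an accepting state. -/
def Rejects (x : List A) : Prop := ¬ M.Accepts x

end TwoNFA

/-! ### Two-way probabilistic finite automata -/

/-- A two-way probabilistic finite automaton (2pfa), with arbitrary real transition
probabilities. -/
structure TwoPFA (A : Type) : Type 1 where
  State : Type
  [fintypeState : Fintype State]
  δ : State → TapeSymbol A → PMF (State × SignType)
  start : State
  acc : Set State
  rej : Set State
  disjoint : Disjoint acc rej

attribute [instance] TwoPFA.fintypeState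

namespace TwoPFA

variable {A : Type} (M : TwoPFA A)

open Classical in
/-- The distribution of the next configuration; a halting configuration is kept forever. -/
noncomputable def next (x : List A) (c : M.State × Cell x) : PMF (M.State × Cell x) :=
  if c.1 ∈ M.acc ∪ M.rej then PMF.pure c
  else (M.δ c.1 (tapeAt x c.2)).map fun pd => (pd.1, moveHead c.2 pd.2)

/-- The distribution of the configuration after `t` steps. -/
noncomputable def dist (x : List A) : ℕ → PMF (M.State × Cell x)
  | 0 => PMF.pure (M.start, 0)
  | t + 1 => (dist x t).bind (M.next x)

/-- The probability that `M` ever accepts `x`: the limit over `t` of the nondecreasing probability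
of having accepted within `t` steps. -/
noncomputable def accProb (x : List A) : ℝ≥0∞ :=
  ⨆ t, (M.dist x t).toOuterMeasure {c | c.1 ∈ M.acc}

/-- The probability that `M` ever rejects `x`. -/
noncomputable def rejProb (x : List A) : ℝ≥0∞ :=
  ⨆ t, (M.dist x t).toOuterMeasure {c | c.1 ∈ M.rej}

end TwoPFA

/-! ### Two-way quantum finite automata with garbage tapes -/

/-- The data of a measure-many two-way quantum finite automaton with a flexible garbage tape.
`δ q σ p d ξ` is the amplitude of the transition from state `q` scanning `σ` to state `p`, with
head move `d`, that appends the garbage `ξ`, where `none` means that nothing is written. -/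
structure PreTwoQFA (A : Type) : Type 1 where
  State : Type
  [fintypeState : Fintype State]
  Garbage : Type
  [fintypeGarbage : Fintype Garbage]
  [nonemptyGarbage : Nonempty Garbage]
  δ : State → TapeSymbol A → State → SignType → Option Garbage → ℂ
  start : State
  acc : Set State
  rej : Set State
  disjoint : Disjoint acc rej

attribute [instance] PreTwoQFA.fintypeState PreTwoQFA.fintypeGarbage PreTwoQFA.nonemptyGarbage

namespace PreTwoQFA

variable {A : Type} (M : PreTwoQFA A)

/-- Surface configurations on `x`: inner state, head position, content of the garbage tape. -/
abbrev Config (x : List A) : Type := M.State × Cell x × List M.Garbage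

/-- The image of the basis vector `c` under the time-evolution operator. -/
noncomputable def column (x : List A) (c : M.Config x) : M.Config x →₀ ℂ :=
  ∑ p : M.State, ∑ d : SignType, ∑ ξ : Option M.Garbage,
    Finsupp.single (p, moveHead c.2.1 d, c.2.2 ++ ξ.toList) (M.δ c.1 (tapeAt x c.2.1) p d ξ)

/-- The time-evolution operator, on finite superpositions of surface configurations (a computation
never leaves these, and they are dense in the Hilbert space of the automaton). -/
noncomputable def evolve (x : List A) : (M.Config x →₀ ℂ) →ₗ[ℂ] (M.Config x →₀ ℂ) :=
  Finsupp.linearCombination ℂ (M.column x)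

/-- Well-formedness: for every input, the time evolution is isometric, that is, it maps the basis
of surface configurations to an orthonormal system. (As garbage is only ever appended, an evolution
that writes garbage with nonzero amplitude cannot be onto, so `U† U = I` is the condition that
makes sense here.) -/
def WellFormed : Prop :=
  ∀ (x : List A),
    (∀ c, ((M.column x c).sum fun b a => starRingEnd ℂ a * M.column x c b) = 1) ∧
    (∀ c c', c ≠ c' → ((M.column x c).sum fun b a => starRingEnd ℂ a * M.column x c' b) = 0)

open Classical in
/-- The (unnormalised) superposition of non-halting configurations after `t` steps, each of which
applies the time evolution and then measures whether the state is accepting, rejecting or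
non-halting. -/
noncomputable def state (x : List A) : ℕ → (M.Config x →₀ ℂ)
  | 0 => Finsupp.single (M.start, 0, []) 1
  | t + 1 => (M.evolve x (state x t)).filter fun c => c.1 ∉ M.acc ∪ M.rej

open Classical in
/-- The squared norm of the projection of `φ` to the configurations whose state lies in `S`. -/
noncomputable def weight {x : List A} (S : Set M.State) (φ : M.Config x →₀ ℂ) : ℝ≥0∞ :=
  (φ.filter fun c => c.1 ∈ S).sum fun _ a => ENNReal.ofReal (‖a‖ ^ 2)

/-- The cumulative acceptance probability: the sum over all steps of the probability of accepting
at that step. -/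
noncomputable def accProb (x : List A) : ℝ≥0∞ :=
  ∑' t, M.weight M.acc (M.evolve x (M.state x t))

/-- The cumulative rejection probability. -/
noncomputable def rejProb (x : List A) : ℝ≥0∞ :=
  ∑' t, M.weight M.rej (M.evolve x (M.state x t))

end PreTwoQFA

/-- A two-way quantum finite automaton with a garbage tape (2qfa); it is always well-formed. -/
structure TwoQFA (A : Type) : Type 1 extends PreTwoQFA A where
  wellFormed : toPreTwoQFA.WellFormed

/-! ### Error criteria -/

namespace PromiseFamily

/-- Bounded error, for a family of machines with the given acceptance and rejection probabilities:
one error bound `ε ∈ [0, 1/2)` serves all `n`. -/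
def BoundedError (L : PromiseFamily) (accP rejP : ℕ → List L.Alphabet → ℝ≥0∞) : Prop :=
  ∃ ε : ℝ, 0 ≤ ε ∧ ε < 1 / 2 ∧ ∀ n,
    (∀ x ∈ L.pos n, ENNReal.ofReal (1 - ε) ≤ accP n x) ∧
    (∀ x ∈ L.neg n, ENNReal.ofReal (1 - ε) ≤ rejP n x)

/-- Unbounded error. -/
def UnboundedError (L : PromiseFamily) (accP rejP : ℕ → List L.Alphabet → ℝ≥0∞) : Prop :=
  ∀ n, (∀ x ∈ L.pos n, 1 / 2 < accP n x) ∧ (∀ x ∈ L.neg n, 1 / 2 ≤ rejP n x)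

end PromiseFamily

/-! ### Nonuniform state complexity classes (polynomials have natural coefficients) -/

/-- `2D`. -/
def Class2D : Set PromiseFamily :=
  {L | ∃ (M : ℕ → TwoDFA L.Alphabet) (p : Polynomial ℕ),
    (∀ n, Fintype.card (M n).State ≤ p.eval n) ∧
    ∀ n, (∀ x ∈ L.pos n, (M n).Accepts x) ∧ (∀ x ∈ L.neg n, (M n).Rejects x)}

/-- `2N`. -/
def Class2N : Set PromiseFamily :=
  {L | ∃ (M : ℕ → TwoNFA L.Alphabet) (p : Polynomial ℕ),
    (∀ n, Fintype.card (M n).State ≤ p.eval n) ∧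
    ∀ n, (∀ x ∈ L.pos n, (M n).Accepts x) ∧ (∀ x ∈ L.neg n, (M n).Rejects x)}

/-- `2BP`. -/
def Class2BP : Set PromiseFamily :=
  {L | ∃ (M : ℕ → TwoPFA L.Alphabet) (p : Polynomial ℕ),
    (∀ n, Fintype.card (M n).State ≤ p.eval n) ∧
    L.BoundedError (fun n => (M n).accProb) (fun n => (M n).rejProb)}

/-- `2P`. -/
def Class2P : Set PromiseFamily :=
  {L | ∃ (M : ℕ → TwoPFA L.Alphabet) (p : Polynomial ℕ),
    (∀ n, Fintype.card (M n).State ≤ p.eval n) ∧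
    L.UnboundedError (fun n => (M n).accProb) (fun n => (M n).rejProb)}

/-- `2BQ`. -/
def Class2BQ : Set PromiseFamily :=
  {L | ∃ (M : ℕ → TwoQFA L.Alphabet) (p r : Polynomial ℕ),
    (∀ n, Fintype.card (M n).State ≤ p.eval n) ∧
    (∀ n, Fintype.card (M n).Garbage ≤ r.eval n) ∧
    L.BoundedError (fun n => (M n).accProb) (fun n => (M n).rejProb)}

/-- `2Q`. -/
def Class2Q : Set PromiseFamily :=
  {L | ∃ (M : ℕ → TwoQFA L.Alphabet) (p r : Polynomial ℕ),
    (∀ n, Fintype.card (M n).State ≤ p.eval n) ∧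
    (∀ n, Fintype.card (M n).Garbage ≤ r.eval n) ∧
    L.UnboundedError (fun n => (M n).accProb) (fun n => (M n).rejProb)}

/-! ### Expectations of observables along a probabilistic computation -/

/-! A deterministic automaton is a probabilistic one and a nondeterministic one, and bounded error
is a special case of unbounded error, so three constructions carry the rest.

Quantum simulation of a 2pfa: take square roots of the transition probabilities as amplitudes and
write the current state and head move to the garbage tape in each step. Since a configuration then
determines its predecessor (`target_injective`), the evolution is isometric and distinct paths never
interfere. Squared amplitudes therefore evolve like probabilities (`qExp_evolve`), and the
simulation accepts and rejects with at least the original probabilities.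

Probabilistic simulation of a 2nfa: guess a move uniformly, and give a fair coin's verdict as soon
as a guess is not legal. The simulation halts almost surely and the two verdicts are equally
probable, so rejection has probability at least `1 / 2` if no accepting path exists, while any
accepting path pushes acceptance strictly above `1 / 2`.

Separation of `2BP` from `2N`: a three-state 2pfa that survives each letter with a suitable real
probability tells unary words of length at most `3 ^ i` from those of length at least `3 ^ (i + 1)`,
for any `i`. Up to equivalence only finitely many 2nfa's have at most `2 ^ n` states, and no two
thresholds are solved by the same language, so some threshold `3 ^ f n` defeats them all.
Nonuniformity permits this `f`, and every polynomial is at most `2 ^ n` for some `n`. -/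

theorem PMF.tsum_map_mul {α β : Type*} (p : PMF α) (f : α → β) (F : β → ℝ≥0∞) :
    ∑' b, p.map f b * F b = ∑' a, p a * F (f a) := by
  classical
  simp only [PMF.map_apply, ← ENNReal.tsum_mul_right]
  rw [ENNReal.tsum_comm]
  congr 1; ext a
  rw [tsum_eq_single (f a)]
  · simp
  · intro b hb
    simp [hb]

namespace TwoPFA

variable {A : Type} (M : TwoPFA A)

/-- The expectation of `F` at the configuration that follows `c`. -/
noncomputable def nextExp (x : List A) (F : M.State × Cell x → ℝ≥0∞) (c : M.State × Cell x) :
    ℝ≥0∞ :=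
  ∑' c', M.next x c c' * F c'

/-- The expectation of `F` at the configuration after `t` steps. -/
noncomputable def distExp (x : List A) (t : ℕ) (F : M.State × Cell x → ℝ≥0∞) : ℝ≥0∞ :=
  ∑' c, M.dist x t c * F c

variable {M} {x : List A}

theorem distExp_zero (F : M.State × Cell x → ℝ≥0∞) : M.distExp x 0 F = F (M.start, 0) := by
  rw [distExp, tsum_eq_single (M.start, 0)]
  · simp [dist]
  · intro c hc
    simp [dist, hc]

/-- Moving one step of time from the distribution to the observable reduces statements about all
times to pointwise statements about `nextExp`. -/
theorem distExp_succ (t : ℕ) (F : M.State × Cell x → ℝ≥0∞) :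
    M.distExp x (t + 1) F = M.distExp x t (M.nextExp x F) := by
  simp only [distExp, nextExp, dist, PMF.bind_apply, ← ENNReal.tsum_mul_right,
    ← ENNReal.tsum_mul_left, mul_assoc]
  exact ENNReal.tsum_comm

theorem distExp_add (t : ℕ) (F G : M.State × Cell x → ℝ≥0∞) :
    M.distExp x t (F + G) = M.distExp x t F + M.distExp x t G := by
  simp only [distExp, Pi.add_apply, mul_add, ENNReal.tsum_add]

theorem distExp_mono (t : ℕ) {F G : M.State × Cell x → ℝ≥0∞} (h : F ≤ G) :
    M.distExp x t F ≤ M.distExp x t G :=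
  ENNReal.tsum_le_tsum fun c => by gcongr; exact h c

theorem distExp_const_mul (t : ℕ) (k : ℝ≥0∞) (F : M.State × Cell x → ℝ≥0∞) :
    M.distExp x t (fun c => k * F c) = k * M.distExp x t F := by
  simp only [distExp, ← ENNReal.tsum_mul_left]
  congr 1; ext c; ring

theorem distExp_one (t : ℕ) : M.distExp x t 1 = 1 := by
  simp only [distExp, Pi.one_apply, mul_one, PMF.tsum_coe]

theorem distExp_indicator (t : ℕ) (S : Set (M.State × Cell x)) :
    M.distExp x t (S.indicator 1) = (M.dist x t).toOuterMeasure S := by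
  rw [distExp, PMF.toOuterMeasure_apply]
  congr 1; ext c
  by_cases h : c ∈ S <;> simp [h]

theorem nextExp_of_halting (F : M.State × Cell x → ℝ≥0∞) {c : M.State × Cell x}
    (hc : c.1 ∈ M.acc ∪ M.rej) : M.nextExp x F c = F c := by
  rw [nextExp, tsum_eq_single c]
  · simp [next, hc]
  · intro c' h
    simp [next, hc, h]

theorem nextExp_of_not_halting (F : M.State × Cell x → ℝ≥0∞) {c : M.State × Cell x}
    (hc : c.1 ∉ M.acc ∪ M.rej) :
    M.nextExp x F c =
      ∑' pd, M.δ c.1 (tapeAt x c.2) pd * F (pd.1, moveHead c.2 pd.2) := by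
  rw [nextExp, next, if_neg hc, PMF.tsum_map_mul]

/-- The probability of having halted in a given set of halting states is nondecreasing. -/
theorem distExp_le_succ {F : M.State × Cell x → ℝ≥0∞}
    (hF : ∀ c, c.1 ∉ M.acc ∪ M.rej → F c = 0) (t : ℕ) :
    M.distExp x t F ≤ M.distExp x (t + 1) F := by
  rw [distExp_succ]
  refine distExp_mono t fun c => ?_
  by_cases hc : c.1 ∈ M.acc ∪ M.rej
  · rw [nextExp_of_halting F hc]
  · simp [hF c hc]

theorem distExp_indicator_le_accProb (t : ℕ) :
    M.distExp x t ({c | c.1 ∈ M.acc}.indicator 1) ≤ M.accProb x := by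
  rw [distExp_indicator]
  exact le_iSup (fun t => (M.dist x t).toOuterMeasure {c | c.1 ∈ M.acc}) t

theorem distExp_indicator_le_rejProb (t : ℕ) :
    M.distExp x t ({c | c.1 ∈ M.rej}.indicator 1) ≤ M.rejProb x := by
  rw [distExp_indicator]
  exact le_iSup (fun t => (M.dist x t).toOuterMeasure {c | c.1 ∈ M.rej}) t

theorem accProb_le_of_distExp_le {a : ℝ≥0∞}
    (h : ∀ t, M.distExp x t ({c | c.1 ∈ M.acc}.indicator 1) ≤ a) : M.accProb x ≤ a :=
  iSup_le fun t => by simpa only [distExp_indicator] using h t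

theorem rejProb_le_of_distExp_le {a : ℝ≥0∞}
    (h : ∀ t, M.distExp x t ({c | c.1 ∈ M.rej}.indicator 1) ≤ a) : M.rejProb x ≤ a :=
  iSup_le fun t => by simpa only [distExp_indicator] using h t

end TwoPFA

/-! ### Deterministic automata as probabilistic and as nondeterministic ones -/

namespace TwoDFA

variable {A : Type}

/-- The 2pfa that follows a 2dfa with probability one. -/
noncomputable abbrev toTwoPFA (M : TwoDFA A) : TwoPFA A where
  State := M.State
  δ q σ := PMF.pure (M.δ q σ)
  start := M.start
  acc := M.acc
  rej := M.rej
  disjoint := M.disjoint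

/-- A 2dfa as a 2nfa that always has exactly one choice. -/
abbrev toTwoNFA (M : TwoDFA A) : TwoNFA A where
  State := M.State
  δ q σ := {M.δ q σ}
  start := M.start
  acc := M.acc
  rej := M.rej
  disjoint := M.disjoint

variable {M : TwoDFA A} {x : List A}

theorem exists_dist_toTwoPFA_eq_pure {c : M.State × Cell x}
    (h : Relation.ReflTransGen (M.Step x) (M.start, 0) c) :
    ∃ t, M.toTwoPFA.dist x t = PMF.pure c := by
  induction h with
  | refl => exact ⟨0, rfl⟩
  | @tail b c _ hbc ih =>
    obtain ⟨t, ht⟩ := ih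
    refine ⟨t + 1, ?_⟩
    rw [TwoPFA.dist, ht, PMF.pure_bind, TwoPFA.next, if_neg hbc.1, hbc.2, PMF.pure_map]

theorem one_le_accProb_toTwoPFA (h : M.Accepts x) : 1 ≤ M.toTwoPFA.accProb x := by
  obtain ⟨c, hc, hacc⟩ := h
  obtain ⟨t, ht⟩ := exists_dist_toTwoPFA_eq_pure hc
  refine le_trans (le_of_eq ?_)
    (le_iSup (fun t => (M.toTwoPFA.dist x t).toOuterMeasure {c | c.1 ∈ M.toTwoPFA.acc}) t)
  simp only [ht]
  rw [PMF.toOuterMeasure_pure_apply, if_pos]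
  exact hacc

theorem one_le_rejProb_toTwoPFA (h : M.Rejects x) : 1 ≤ M.toTwoPFA.rejProb x := by
  obtain ⟨c, hc, hrej⟩ := h
  obtain ⟨t, ht⟩ := exists_dist_toTwoPFA_eq_pure hc
  refine le_trans (le_of_eq ?_)
    (le_iSup (fun t => (M.toTwoPFA.dist x t).toOuterMeasure {c | c.1 ∈ M.toTwoPFA.rej}) t)
  simp only [ht]
  rw [PMF.toOuterMeasure_pure_apply, if_pos]
  exact hrej

theorem step_toTwoNFA {c c' : M.State × Cell x} :
    M.toTwoNFA.Step x c c' ↔ M.Step x c c' := by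
  simp only [TwoNFA.Step, Step, Set.mem_singleton_iff, exists_eq_left]

theorem accepts_toTwoNFA (h : M.Accepts x) : M.toTwoNFA.Accepts x := by
  obtain ⟨c, hc, hacc⟩ := h
  exact ⟨c, Relation.ReflTransGen.mono (fun _ _ => step_toTwoNFA.2) _ _ hc, hacc⟩

/-- Computations are deterministic, so a rejecting computation excludes an accepting one. -/
theorem rejects_toTwoNFA (h : M.Rejects x) : M.toTwoNFA.Rejects x := by
  rintro ⟨c, hc, hacc⟩
  obtain ⟨c', hc', hrej⟩ := h
  replace hc : Relation.ReflTransGen (M.Step x) (M.start, 0) c :=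
    Relation.ReflTransGen.mono (fun _ _ => step_toTwoNFA.1) _ _ hc
  have hdet : Relator.RightUnique (M.Step x) := fun a b b' h h' => h.2.trans h'.2.symm
  have hstuck : ∀ {a b : M.State × Cell x}, a.1 ∈ M.acc ∪ M.rej →
      Relation.ReflTransGen (M.Step x) a b → a = b := fun ha hab => by
    rcases hab.cases_head with h | ⟨_, h, _⟩
    · exact h
    · exact absurd ha h.1
  have heq : c = c' := by
    -- Of two computations of a deterministic machine one extends the other, and a halting
    -- configuration has no proper extension.
    rcases Relation.ReflTransGen.total_of_right_unique hdet hc hc' with h | h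
    · exact hstuck (Or.inl hacc) h
    · exact (hstuck (Or.inr hrej) h).symm
  exact Set.disjoint_left.1 M.disjoint hacc (heq ▸ hrej)

end TwoDFA

theorem Class2D_subset_Class2BP : Class2D ⊆ Class2BP := by
  rintro L ⟨M, p, hp, hM⟩
  refine ⟨fun n => (M n).toTwoPFA, p, hp, 0, le_rfl, by norm_num, fun n => ⟨fun x hx => ?_,
    fun x hx => ?_⟩⟩
  · simpa using TwoDFA.one_le_accProb_toTwoPFA ((hM n).1 x hx)
  · simpa using TwoDFA.one_le_rejProb_toTwoPFA ((hM n).2 x hx)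

theorem Class2D_subset_Class2N : Class2D ⊆ Class2N := by
  rintro L ⟨M, p, hp, hM⟩
  exact ⟨fun n => (M n).toTwoNFA, p, hp, fun n =>
    ⟨fun x hx => TwoDFA.accepts_toTwoNFA ((hM n).1 x hx),
      fun x hx => TwoDFA.rejects_toTwoNFA ((hM n).2 x hx)⟩⟩

theorem PromiseFamily.BoundedError.unboundedError {L : PromiseFamily}
    {accP rejP : ℕ → List L.Alphabet → ℝ≥0∞} (h : L.BoundedError accP rejP) :
    L.UnboundedError accP rejP := by
  obtain ⟨ε, -, hε, h⟩ := h
  have key : (1 / 2 : ℝ≥0∞) < ENNReal.ofReal (1 - ε) := by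
    rw [show (1 / 2 : ℝ≥0∞) = ENNReal.ofReal (1 / 2) by
      rw [ENNReal.ofReal_div_of_pos two_pos]; simp]
    exact (ENNReal.ofReal_lt_ofReal_iff (by linarith)).2 (by linarith)
  exact fun n => ⟨fun x hx => key.trans_le ((h n).1 x hx),
    fun x hx => key.le.trans ((h n).2 x hx)⟩

theorem Class2BQ_subset_Class2Q : Class2BQ ⊆ Class2Q := by
  rintro L ⟨M, p, r, hp, hr, h⟩
  exact ⟨M, p, r, hp, hr, h.unboundedError⟩

/-! ### Quantum simulation of probabilistic automata -/

namespace TwoPFA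

variable {A : Type} (M : TwoPFA A)

open Classical in
/-- The transition probabilities in which a halting state is kept forever with an idle head. -/
noncomputable def loopδ (q : M.State) (σ : TapeSymbol A) : PMF (M.State × SignType) :=
  if q ∈ M.acc ∪ M.rej then PMF.pure (q, 0) else M.δ q σ

/-- The amplitude of a transition: the square root of its probability. -/
noncomputable def amp (q : M.State) (σ : TapeSymbol A) (pd : M.State × SignType) : ℂ :=
  (Real.sqrt (M.loopδ q σ pd).toReal : ℂ)

open Classical in
/-- The 2qfa that simulates a 2pfa by writing the current state and head move to the garbage tape in
every step, which keeps different computation paths orthogonal. -/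
noncomputable abbrev toPreTwoQFA : PreTwoQFA A where
  State := M.State
  Garbage := M.State × SignType
  nonemptyGarbage := ⟨(M.start, 0)⟩
  δ q σ p d ξ := if ξ = some (q, d) then M.amp q σ (p, d) else 0
  start := M.start
  acc := M.acc
  rej := M.rej
  disjoint := M.disjoint

variable {M} {x : List A}

/-- Isometry concerns halting configurations too, so halting states need genuine transitions. The
idle loop of `loopδ` supplies them without changing `nextExp`. -/
theorem nextExp_eq_sum_loopδ (F : M.State × Cell x → ℝ≥0∞) (c : M.State × Cell x) :
    M.nextExp x F c =
      ∑ pd, M.loopδ c.1 (tapeAt x c.2) pd * F (pd.1, moveHead c.2 pd.2) := by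
  classical
  by_cases hc : c.1 ∈ M.acc ∪ M.rej
  · rw [nextExp_of_halting F hc, loopδ, if_pos hc, Finset.sum_eq_single (c.1, 0)]
    · simp [moveHead]
    · intro b _ hb
      simp [hb]
    · simp
  · rw [nextExp_of_not_halting F hc, loopδ, if_neg hc, tsum_fintype]

theorem star_amp (q : M.State) (σ : TapeSymbol A) (pd : M.State × SignType) :
    starRingEnd ℂ (M.amp q σ pd) * M.amp q σ pd = ((M.loopδ q σ pd).toReal : ℂ) := by
  rw [amp, Complex.conj_ofReal, ← Complex.ofReal_mul, Real.mul_self_sqrt ENNReal.toReal_nonneg]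

theorem ofReal_norm_amp_sq (q : M.State) (σ : TapeSymbol A) (pd : M.State × SignType) :
    ENNReal.ofReal (‖M.amp q σ pd‖ ^ 2) = M.loopδ q σ pd := by
  rw [amp, Complex.norm_real, Real.norm_of_nonneg (Real.sqrt_nonneg _),
    Real.sq_sqrt ENNReal.toReal_nonneg, ENNReal.ofReal_toReal (PMF.apply_ne_top _ _)]

/-- The configuration reached by a transition of the simulating 2qfa. -/
def target (x : List A) (c : M.toPreTwoQFA.Config x × M.State × SignType) :
    M.toPreTwoQFA.Config x :=
  (c.2.1, moveHead c.1.2.1 c.2.2, c.1.2.2 ++ [(c.1.1, c.2.2)])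

/-- The last garbage symbol reveals the previous state and the head move; removing the symbol and
undoing the move recovers the previous configuration. -/
theorem target_injective : Function.Injective (target (M := M) x) := by
  rintro ⟨⟨q, i, g⟩, p, d⟩ ⟨⟨q', i', g'⟩, p', d'⟩ h
  simp only [target, Prod.mk.injEq] at h
  obtain ⟨rfl, hi, hg⟩ := h
  obtain ⟨rfl, hqd⟩ := List.append_inj' hg rfl
  obtain ⟨rfl, rfl⟩ := Prod.mk.inj (List.singleton_inj.1 hqd)
  rw [add_right_cancel hi]

theorem column_eq_sum (c : M.toPreTwoQFA.Config x) :
    M.toPreTwoQFA.column x c =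
      ∑ pd, Finsupp.single (target x (c, pd)) (M.amp c.1 (tapeAt x c.2.1) pd) := by
  classical
  rw [PreTwoQFA.column, Fintype.sum_prod_type]
  refine Finset.sum_congr rfl fun p _ => Finset.sum_congr rfl fun d _ => ?_
  rw [Finset.sum_eq_single (some (c.1, d))]
  · simp [target]
  · intro ξ _ hξ
    simp [hξ]
  · simp

open Classical in
theorem column_target (c c' : M.toPreTwoQFA.Config x) (pd : M.State × SignType) :
    M.toPreTwoQFA.column x c (target x (c', pd)) =
      if c = c' then M.amp c.1 (tapeAt x c.2.1) pd else 0 := by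
  rw [column_eq_sum, Finsupp.finsetSum_apply]
  simp only [Finsupp.single_apply, target_injective.eq_iff, Prod.mk.injEq]
  by_cases h : c = c' <;> simp [h]

theorem column_of_notMem_range (c : M.toPreTwoQFA.Config x) {b : M.toPreTwoQFA.Config x}
    (hb : b ∉ Set.range (target (M := M) x)) : M.toPreTwoQFA.column x c b = 0 := by
  classical
  rw [column_eq_sum, Finsupp.finsetSum_apply]
  refine Finset.sum_eq_zero fun pd _ => ?_
  rw [Finsupp.single_apply, if_neg]
  exact fun h => hb ⟨_, h⟩

open Classical in
-- Different columns have disjoint supports by `target_injective`, and the squared norm of one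
-- column is the total mass of a probability distribution.
theorem inner_column (c c' : M.toPreTwoQFA.Config x) :
    ((M.toPreTwoQFA.column x c).sum fun b a =>
      starRingEnd ℂ a * M.toPreTwoQFA.column x c' b) = if c = c' then 1 else 0 := by
  rw [column_eq_sum c, ← Finsupp.sum_finsetSum_index (by simp) (by simp [add_mul])]
  simp only [Finsupp.sum_single_index, map_zero, zero_mul, column_target, eq_comm (a := c')]
  split_ifs with h
  · subst h
    simp only [star_amp]
    rw [← Complex.ofReal_sum, ← ENNReal.toReal_sum fun _ _ => PMF.apply_ne_top _ _,
      ← tsum_fintype (L := .unconditional _), PMF.tsum_coe]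
    simp
  · simp

theorem wellFormed_toPreTwoQFA : M.toPreTwoQFA.WellFormed := fun x =>
  ⟨fun c => by rw [inner_column, if_pos rfl], fun c c' h => by rw [inner_column, if_neg h]⟩

theorem evolve_target (φ : M.toPreTwoQFA.Config x →₀ ℂ) (c : M.toPreTwoQFA.Config x)
    (pd : M.State × SignType) :
    M.toPreTwoQFA.evolve x φ (target x (c, pd)) = φ c * M.amp c.1 (tapeAt x c.2.1) pd := by
  classical
  rw [PreTwoQFA.evolve, Finsupp.linearCombination_apply, Finsupp.sum_apply]
  simp only [Finsupp.smul_apply, column_target, smul_eq_mul]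
  rw [Finsupp.sum, Finset.sum_eq_single c]
  · simp
  · intro b _ hb
    simp [hb]
  · intro h
    simp [Finsupp.notMem_support_iff.1 h]

theorem evolve_of_notMem_range (φ : M.toPreTwoQFA.Config x →₀ ℂ) {b : M.toPreTwoQFA.Config x}
    (hb : b ∉ Set.range (target (M := M) x)) : M.toPreTwoQFA.evolve x φ b = 0 := by
  rw [PreTwoQFA.evolve, Finsupp.linearCombination_apply, Finsupp.sum_apply]
  simp [column_of_notMem_range _ hb, Finsupp.sum]

/-- The sum of the squared norms of the amplitudes, weighted by an observable that ignores the
garbage tape. -/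
noncomputable def qExp (F : M.State × Cell x → ℝ≥0∞) (φ : M.toPreTwoQFA.Config x →₀ ℂ) : ℝ≥0∞ :=
  ∑' b : M.toPreTwoQFA.Config x, F (b.1, b.2.1) * ENNReal.ofReal (‖φ b‖ ^ 2)

/-- This is the quantum counterpart of `distExp_succ`. Each basis vector in the image receives
amplitude from a single predecessor, so squared norms multiply with transition probabilities and no
cross terms arise. -/
theorem qExp_evolve (F : M.State × Cell x → ℝ≥0∞) (φ : M.toPreTwoQFA.Config x →₀ ℂ) :
    qExp F (M.toPreTwoQFA.evolve x φ) = qExp (M.nextExp x F) φ := by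
  rw [qExp, ← target_injective.tsum_eq, ENNReal.tsum_prod']
  · refine tsum_congr fun c => ?_
    rw [tsum_fintype, nextExp_eq_sum_loopδ, Finset.sum_mul]
    refine Finset.sum_congr rfl fun pd _ => ?_
    rw [evolve_target, norm_mul, mul_pow, ENNReal.ofReal_mul (by positivity), ofReal_norm_amp_sq]
    simp only [target]
    ring
  · intro b hb
    by_contra h
    simp [evolve_of_notMem_range φ h] at hb

theorem weight_eq_qExp (S : Set M.State) (φ : M.toPreTwoQFA.Config x →₀ ℂ) :
    M.toPreTwoQFA.weight S φ = qExp ({c | c.1 ∈ S}.indicator 1) φ := by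
  classical
  rw [PreTwoQFA.weight, qExp, Finsupp.sum, tsum_eq_sum (s := (φ.filter fun c => c.1 ∈ S).support)]
  · refine Finset.sum_congr rfl fun b hb => ?_
    have h : b.1 ∈ S := by
      simp only [Finsupp.support_filter, Finset.mem_filter] at hb
      exact hb.2
    rw [Finsupp.filter_apply_pos (fun c : M.toPreTwoQFA.Config x => c.1 ∈ S) _ h, Set.indicator_of_mem (by exact h)]
    simp
  · intro b hb
    by_cases h : b.1 ∈ S
    · have : φ b = 0 := by simpa [h] using hb
      simp [this]
    · rw [Set.indicator_of_notMem (by exact h), zero_mul]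

/-- The measurement deletes only halting configurations, which `F` does not see. -/
theorem qExp_state_succ {F : M.State × Cell x → ℝ≥0∞}
    (hF : ∀ c, c.1 ∈ M.acc ∪ M.rej → F c = 0) (t : ℕ) :
    qExp F (M.toPreTwoQFA.state x (t + 1)) =
      qExp (M.nextExp x F) (M.toPreTwoQFA.state x t) := by
  classical
  rw [← qExp_evolve, PreTwoQFA.state, qExp, qExp]
  refine tsum_congr fun b => ?_
  by_cases h : b.1 ∈ M.acc ∪ M.rej
  · simp [hF (b.1, b.2.1) h]
  · rw [Finsupp.filter_apply_pos (fun c : M.toPreTwoQFA.Config x => c.1 ∉ M.acc ∪ M.rej) _ h]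

theorem qExp_state_zero (F : M.State × Cell x → ℝ≥0∞) :
    qExp F (M.toPreTwoQFA.state x 0) = F (M.start, 0) := by
  classical
  rw [qExp, PreTwoQFA.state, tsum_eq_single (M.start, 0, [])]
  · simp
  · intro b hb
    simp [hb.symm]

/-- The simulation is faithful on nonhalting configurations. -/
theorem distExp_eq_qExp_state (t : ℕ) : ∀ {F : M.State × Cell x → ℝ≥0∞},
    (∀ c, c.1 ∈ M.acc ∪ M.rej → F c = 0) →
      M.distExp x t F = qExp F (M.toPreTwoQFA.state x t) := by
  induction t with
  | zero => intro F _; rw [distExp_zero, qExp_state_zero]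
  | succ t ih =>
    intro F hF
    rw [distExp_succ, qExp_state_succ hF]
    exact ih fun c hc => (nextExp_of_halting F hc).trans (hF c hc)

theorem qExp_mono {F G : M.State × Cell x → ℝ≥0∞} (h : F ≤ G)
    (φ : M.toPreTwoQFA.Config x →₀ ℂ) : qExp F φ ≤ qExp G φ :=
  ENNReal.tsum_le_tsum fun b => by gcongr; exact h _

/-- Mass newly arriving in `S` comes from nonhalting configurations, and on these the probabilistic
and the quantum computation agree. -/
theorem distExp_halting_succ_le {S : Set M.State} (hS : S ⊆ M.acc ∪ M.rej) (t : ℕ) :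
    M.distExp x (t + 1) ({c | c.1 ∈ S}.indicator 1) ≤
      M.distExp x t ({c | c.1 ∈ S}.indicator 1) +
        M.toPreTwoQFA.weight S (M.toPreTwoQFA.evolve x (M.toPreTwoQFA.state x t)) := by
  classical
  set F : M.State × Cell x → ℝ≥0∞ := {c | c.1 ∈ S}.indicator 1
  have hsplit : M.nextExp x F = F + {c | c.1 ∉ M.acc ∪ M.rej}.indicator (M.nextExp x F) := by
    ext c
    by_cases hc : c.1 ∈ M.acc ∪ M.rej
    · rw [Pi.add_apply, Set.indicator_of_notMem (by exact fun h => h hc), add_zero,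
        nextExp_of_halting F hc]
    · have : c ∉ {c : M.State × Cell x | c.1 ∈ S} := fun h => hc (hS h)
      rw [Pi.add_apply, Set.indicator_of_mem (by exact hc), show F c = 0 from
        Set.indicator_of_notMem this _, zero_add]
  rw [distExp_succ, hsplit, distExp_add, weight_eq_qExp, qExp_evolve, distExp_eq_qExp_state t
    (F := {c | c.1 ∉ M.acc ∪ M.rej}.indicator (M.nextExp x F))]
  · gcongr
    exact qExp_mono (Set.indicator_le_self _ _) _
  · intro c hc
    exact Set.indicator_of_notMem (by exact fun h => h hc) _

theorem distExp_halting_le_tsum {S : Set M.State} (hS : S ⊆ M.acc ∪ M.rej) (t : ℕ) :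
    M.distExp x t ({c | c.1 ∈ S}.indicator 1) ≤
      ∑' t, M.toPreTwoQFA.weight S (M.toPreTwoQFA.evolve x (M.toPreTwoQFA.state x t)) := by
  by_cases hstart : M.start ∈ S
  · calc
      M.distExp x t ({c | c.1 ∈ S}.indicator 1) ≤ M.distExp x t 1 :=
        distExp_mono t (Set.indicator_le_self _ _)
      _ = 1 := distExp_one t
      _ = M.toPreTwoQFA.weight S (M.toPreTwoQFA.evolve x (M.toPreTwoQFA.state x 0)) := by
        rw [weight_eq_qExp, qExp_evolve, qExp_state_zero, nextExp_of_halting _ (hS hstart),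
          Set.indicator_of_mem (by exact hstart)]
        rfl
      _ ≤ _ := ENNReal.le_tsum 0
  · refine le_trans ?_ (ENNReal.sum_le_tsum (Finset.range t))
    induction t with
    | zero => simp [distExp_zero, hstart]
    | succ t ih =>
      rw [Finset.sum_range_succ]
      exact (distExp_halting_succ_le hS t).trans (by gcongr)

theorem accProb_le_accProb_toPreTwoQFA : M.accProb x ≤ M.toPreTwoQFA.accProb x :=
  accProb_le_of_distExp_le fun t => distExp_halting_le_tsum Set.subset_union_left t

theorem rejProb_le_rejProb_toPreTwoQFA : M.rejProb x ≤ M.toPreTwoQFA.rejProb x :=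
  rejProb_le_of_distExp_le fun t => distExp_halting_le_tsum Set.subset_union_right t

variable (M) in
/-- The 2qfa that simulates a 2pfa. -/
noncomputable abbrev toTwoQFA : TwoQFA A where
  toPreTwoQFA := M.toPreTwoQFA
  wellFormed := wellFormed_toPreTwoQFA

theorem card_garbage_toTwoQFA_le {k : ℕ} (h : Fintype.card M.State ≤ k) :
    Fintype.card M.toTwoQFA.Garbage ≤ k * 3 := by
  have : Fintype.card (M.State × SignType) ≤ k * 3 := by
    rw [Fintype.card_prod, show Fintype.card SignType = 3 from rfl]
    gcongr
  exact this

end TwoPFA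

theorem Class2BP_subset_Class2BQ : Class2BP ⊆ Class2BQ := by
  rintro L ⟨M, p, hp, ε, h0, hε, h⟩
  exact ⟨fun n => (M n).toTwoQFA, p, p * 3, hp,
    fun n => by simpa using TwoPFA.card_garbage_toTwoQFA_le (hp n), ε, h0, hε, fun n =>
      ⟨fun x hx => ((h n).1 x hx).trans TwoPFA.accProb_le_accProb_toPreTwoQFA,
        fun x hx => ((h n).2 x hx).trans TwoPFA.rejProb_le_rejProb_toPreTwoQFA⟩⟩

theorem Class2P_subset_Class2Q : Class2P ⊆ Class2Q := by
  rintro L ⟨M, p, hp, h⟩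
  exact ⟨fun n => (M n).toTwoQFA, p, p * 3, hp,
    fun n => by simpa using TwoPFA.card_garbage_toTwoQFA_le (hp n), fun n =>
      ⟨fun x hx => ((h n).1 x hx).trans_le TwoPFA.accProb_le_accProb_toPreTwoQFA,
        fun x hx => ((h n).2 x hx).trans TwoPFA.rejProb_le_rejProb_toPreTwoQFA⟩⟩

/-! ### Probabilistic simulation of nondeterministic automata -/

namespace TwoNFA

variable {A : Type} (M : TwoNFA A)

open Classical in
/-- The choice `(o, b)` of the probabilistic simulation leads to the proposed successor `o` if this
is a legal move, and else halts, accepting or rejecting according to the coin `b`. -/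
noncomputable def guess (q : M.State) (σ : TapeSymbol A)
    (ob : Option (M.State × SignType) × Bool) : (M.State ⊕ Bool) × SignType :=
  match ob with
  -- A 2nfa has no step out of a rejecting state, so there every guess is illegal.
  | (some pd, b) => if pd ∈ M.δ q σ ∧ q ∉ M.rej then (.inl pd.1, pd.2) else (.inr b, 0)
  | (none, b) => (.inr b, 0)

/-- The 2pfa that guesses each step of a 2nfa, and halts with a fair verdict after each guess that
is not a legal step. -/
noncomputable abbrev toTwoPFA : TwoPFA A where
  State := M.State ⊕ Bool
  δ
    | .inl q, σ => (PMF.uniformOfFintype _).map (M.guess q σ)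
    | .inr b, _ => PMF.pure (.inr b, 0)
  start := .inl M.start
  acc := Sum.inl '' M.acc ∪ {.inr true}
  -- Rejecting states of the 2nfa do not halt the simulation: a path ending there must be settled by
  -- the fair coin, as outright rejection could outweigh the accepting paths.
  rej := {.inr false}
  disjoint := by simp

variable {M} {x : List A}

theorem inl_mem_halting {q : M.State} :
    (.inl q : M.State ⊕ Bool) ∈ M.toTwoPFA.acc ∪ M.toTwoPFA.rej ↔ q ∈ M.acc := by
  simp

theorem inr_mem_halting (b : Bool) :
    (.inr b : M.State ⊕ Bool) ∈ M.toTwoPFA.acc ∪ M.toTwoPFA.rej := by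
  cases b <;> simp

/-- The probability of each single guess. -/
noncomputable def guessProb (M : TwoNFA A) : ℝ≥0∞ :=
  (Fintype.card (Option (M.State × SignType) × Bool) : ℝ≥0∞)⁻¹

theorem guessProb_pos : 0 < M.guessProb := ENNReal.inv_pos.2 (ENNReal.natCast_ne_top _)

theorem sum_guessProb :
    ∑ _ob : Option (M.State × SignType) × Bool, M.guessProb = 1 := by
  rw [Finset.sum_const, Finset.card_univ, nsmul_eq_mul, guessProb, ENNReal.mul_inv_cancel]
  · exact Nat.cast_ne_zero.2 Fintype.card_ne_zero
  · exact ENNReal.natCast_ne_top _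

theorem nextExp_inl (F : (M.State ⊕ Bool) × Cell x → ℝ≥0∞) {q : M.State} (hq : q ∉ M.acc)
    (i : Cell x) :
    M.toTwoPFA.nextExp x F (.inl q, i) =
      ∑ ob, M.guessProb *
        F ((M.guess q (tapeAt x i) ob).1, moveHead i (M.guess q (tapeAt x i) ob).2) := by
  rw [TwoPFA.nextExp_of_not_halting (M := M.toTwoPFA) F (fun h => hq (inl_mem_halting.1 h)),
    PMF.tsum_map_mul (PMF.uniformOfFintype _) _
      (fun pd : (M.State ⊕ Bool) × SignType => F (pd.1, moveHead i pd.2)), tsum_fintype]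
  simp [guessProb]

theorem nextExp_inr (F : (M.State ⊕ Bool) × Cell x → ℝ≥0∞) (b : Bool) (i : Cell x) :
    M.toTwoPFA.nextExp x F (.inr b, i) = F (.inr b, i) :=
  TwoPFA.nextExp_of_halting (M := M.toTwoPFA) F (inr_mem_halting b)

theorem nextExp_inl_acc (F : (M.State ⊕ Bool) × Cell x → ℝ≥0∞) {q : M.State} (hq : q ∈ M.acc)
    (i : Cell x) : M.toTwoPFA.nextExp x F (.inl q, i) = F (.inl q, i) :=
  TwoPFA.nextExp_of_halting (M := M.toTwoPFA) F (inl_mem_halting.2 hq)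

/-- The configurations in which a verdict has been given by the coin. -/
def verdict (M : TwoNFA A) (x : List A) (b : Bool) : Set ((M.State ⊕ Bool) × Cell x) :=
  {c | c.1 = .inr b}

/-- The configurations in which the simulated 2nfa has accepted. -/
def simAcc (M : TwoNFA A) (x : List A) : Set ((M.State ⊕ Bool) × Cell x) :=
  {c | c.1 ∈ Sum.inl '' M.acc}

/-- The configurations in which the simulation has not ended. -/
def running (M : TwoNFA A) (x : List A) : Set ((M.State ⊕ Bool) × Cell x) :=
  {c | c.1 ∈ Sum.inl '' M.accᶜ}

@[simp]
theorem inl_mem_simAcc {q : M.State} {i : Cell x} : (.inl q, i) ∈ M.simAcc x ↔ q ∈ M.acc := by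
  simp [simAcc]

@[simp]
theorem inr_notMem_simAcc {b : Bool} {i : Cell x} : (.inr b, i) ∉ M.simAcc x := by
  simp [simAcc]

@[simp]
theorem inl_mem_running {q : M.State} {i : Cell x} : (.inl q, i) ∈ M.running x ↔ q ∉ M.acc := by
  simp [running]

@[simp]
theorem inr_notMem_running {b : Bool} {i : Cell x} : (.inr b, i) ∉ M.running x := by
  simp [running]

@[simp]
theorem inl_notMem_verdict {b : Bool} {q : M.State} {i : Cell x} :
    (.inl q, i) ∉ M.verdict x b := by
  simp [verdict]

@[simp]
theorem inr_mem_verdict {b b' : Bool} {i : Cell x} : (.inr b, i) ∈ M.verdict x b' ↔ b = b' := by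
  simp [verdict]

/-- The two verdicts are equally probable at all times. -/
theorem distExp_verdict_eq (t : ℕ) :
    M.toTwoPFA.distExp x t ((M.verdict x true).indicator 1) =
      M.toTwoPFA.distExp x t ((M.verdict x false).indicator 1) := by
  classical
  -- A verdict is final, so its probability grows only by mass from running configurations.
  have hsplit : ∀ b, M.toTwoPFA.nextExp x ((M.verdict x b).indicator 1) =
      (M.verdict x b).indicator 1 +
        (M.running x).indicator (M.toTwoPFA.nextExp x ((M.verdict x b).indicator 1)) := by
    intro b
    ext ⟨q | b', i⟩
    · by_cases hq : q ∈ M.acc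
      · rw [Pi.add_apply, nextExp_inl_acc _ hq, Set.indicator_of_notMem (s := M.running x),
          add_zero]
        exact fun h => inl_mem_running.1 h hq
      · rw [Pi.add_apply, Set.indicator_of_mem (s := M.running x) (inl_mem_running.2 hq),
          Set.indicator_of_notMem (s := M.verdict x b) inl_notMem_verdict, zero_add]
    · rw [Pi.add_apply, nextExp_inr, Set.indicator_of_notMem (s := M.running x) inr_notMem_running,
        add_zero]
  have hsymm : (M.running x).indicator (M.toTwoPFA.nextExp x ((M.verdict x true).indicator 1)) =
      (M.running x).indicator (M.toTwoPFA.nextExp x ((M.verdict x false).indicator 1)) := by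
    refine Set.indicator_congr ?_
    rintro ⟨q | b', i⟩ hq
    · rw [inl_mem_running] at hq
      rw [nextExp_inl _ hq, nextExp_inl _ hq, Fintype.sum_prod_type, Fintype.sum_prod_type]
      refine Finset.sum_congr rfl fun o _ => ?_
      -- Flipping the coin exchanges the two verdicts and keeps the probability of the guess.
      rw [Fintype.sum_bool, Fintype.sum_bool, add_comm]
      rcases o with _ | pd
      · simp [guess]
      · by_cases h : pd ∈ M.δ q (tapeAt x i) ∧ q ∉ M.rej
        · simp [guess, h]
        · simp [guess, h]
    · exact absurd hq inr_notMem_running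
  induction t with
  | zero => simp [TwoPFA.distExp_zero]
  | succ t ih =>
    rw [TwoPFA.distExp_succ, TwoPFA.distExp_succ, hsplit true, hsplit false,
      TwoPFA.distExp_add, TwoPFA.distExp_add, ih, hsymm]

theorem distExp_acc (t : ℕ) :
    M.toTwoPFA.distExp x t ({c | c.1 ∈ M.toTwoPFA.acc}.indicator 1) =
      M.toTwoPFA.distExp x t ((M.verdict x true).indicator 1) +
        M.toTwoPFA.distExp x t ((M.simAcc x).indicator 1) := by
  classical
  rw [← TwoPFA.distExp_add]
  congr 1
  ext ⟨q | b, i⟩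
  · by_cases h : q ∈ M.acc <;>
      simp [h]
  · cases b <;> simp

theorem distExp_rej (t : ℕ) :
    M.toTwoPFA.distExp x t ({c | c.1 ∈ M.toTwoPFA.rej}.indicator 1) =
      M.toTwoPFA.distExp x t ((M.verdict x false).indicator 1) :=
  rfl

/-- Every configuration is running, an acceptance of the 2nfa, or one of two equally probable
verdicts. -/
theorem distExp_total (t : ℕ) :
    2 * M.toTwoPFA.distExp x t ((M.verdict x false).indicator 1) +
      M.toTwoPFA.distExp x t ((M.simAcc x).indicator 1) +
        M.toTwoPFA.distExp x t ((M.running x).indicator 1) = 1 := by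
  classical
  rw [two_mul]
  nth_rewrite 1 [← distExp_verdict_eq]
  rw [← TwoPFA.distExp_add, ← TwoPFA.distExp_add, ← TwoPFA.distExp_add,
    ← TwoPFA.distExp_one (M := M.toTwoPFA) (x := x) t]
  congr 1
  ext ⟨q | b, i⟩
  · by_cases h : q ∈ M.acc <;>
      simp [h]
  · cases b <;>
      simp

/-- The running simulation ends with at least a fixed probability in each step. -/
theorem exists_distExp_running_le :
    ∃ k < 1, ∀ t, M.toTwoPFA.distExp x t ((M.running x).indicator 1) ≤ k ^ t := by
  classical
  set f : Option (M.State × SignType) × Bool → ℝ≥0∞ :=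
    fun ob => M.guessProb * if ob.1 = none then 0 else 1
  refine ⟨∑ ob, f ob, ?_, fun t => ?_⟩
  -- The guess `none` is never a legal move, so the choice `(none, true)` alone already keeps the
  -- survival factor below `1`.
  · have hle : ∑ ob, f ob + M.guessProb ≤ 1 := by
      rw [← Fintype.sum_ite_eq (none, true) fun _ : Option (M.State × SignType) × Bool =>
        M.guessProb, ← Finset.sum_add_distrib, ← sum_guessProb (M := M)]
      refine Finset.sum_le_sum fun ⟨o, b⟩ _ => ?_
      rcases o with _ | pd
      · simp only [f, if_true, mul_zero, zero_add]
        split_ifs <;> simp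
      · simp [f]
    refine (ENNReal.lt_add_right ?_ guessProb_pos.ne').trans_le hle
    exact ne_top_of_le_ne_top ENNReal.one_ne_top (le_self_add.trans hle)
  · have hstep : M.toTwoPFA.nextExp x ((M.running x).indicator 1) ≤
        fun c => (∑ ob, f ob) * (M.running x).indicator 1 c := by
      rintro ⟨q | b, i⟩
      · by_cases hq : q ∈ M.acc
        · rw [nextExp_inl_acc _ hq, Set.indicator_of_notMem]
          · exact zero_le
          · exact fun h => inl_mem_running.1 h hq
        · beta_reduce
          rw [nextExp_inl _ hq, Set.indicator_of_mem (inl_mem_running.2 hq), Pi.one_apply, mul_one]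
          refine Finset.sum_le_sum fun ⟨o, b⟩ _ => ?_
          rcases o with _ | pd
          · simp [guess]
          · simp only [f, reduceCtorEq, if_false]
            gcongr
            exact Set.indicator_le_self _ _ _
      · rw [nextExp_inr, Set.indicator_of_notMem inr_notMem_running]
        exact zero_le
    induction t with
    | zero =>
      rw [TwoPFA.distExp_zero, pow_zero]
      exact Set.indicator_le_self _ _ _
    | succ t ih =>
      rw [TwoPFA.distExp_succ, pow_succ']
      refine (TwoPFA.distExp_mono t hstep).trans ?_
      rw [TwoPFA.distExp_const_mul]
      gcongr

theorem tendsto_distExp_running :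
    Filter.Tendsto (fun t => M.toTwoPFA.distExp x t ((M.running x).indicator 1)) Filter.atTop
      (nhds 0) := by
  obtain ⟨k, hk, h⟩ := exists_distExp_running_le (M := M) (x := x)
  exact tendsto_of_tendsto_of_tendsto_of_le_of_le tendsto_const_nhds
    (ENNReal.tendsto_pow_atTop_nhds_zero_of_lt_one hk) (fun _ => zero_le) h

/-- The simulation follows only computation paths of the 2nfa. -/
theorem reflTransGen_of_dist_ne_zero (t : ℕ) : ∀ {q : M.State} {i : Cell x},
    M.toTwoPFA.dist x t (.inl q, i) ≠ 0 →
      Relation.ReflTransGen (M.Step x) (M.start, 0) (q, i) := by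
  induction t with
  | zero =>
    intro q i h
    rw [← PMF.mem_support_iff, TwoPFA.dist, PMF.mem_support_pure_iff, Prod.mk.injEq,
      Sum.inl.injEq] at h
    rw [h.1, h.2]
  | succ t ih =>
    intro q i h
    rw [← PMF.mem_support_iff, TwoPFA.dist, PMF.mem_support_bind_iff] at h
    obtain ⟨⟨q' | b, j⟩, hc, h⟩ := h
    · by_cases hq : q' ∈ M.acc
      · rw [TwoPFA.next, if_pos (inl_mem_halting.2 hq), PMF.mem_support_pure_iff, Prod.mk.injEq,
          Sum.inl.injEq] at h
        rw [h.1, h.2]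
        exact ih hc
      · rw [TwoPFA.next, if_neg fun h => hq (inl_mem_halting.1 h), PMF.mem_support_map_iff] at h
        obtain ⟨pd, hpd, heq⟩ := h
        rw [PMF.mem_support_map_iff] at hpd
        obtain ⟨⟨o, b⟩, -, rfl⟩ := hpd
        refine (ih hc).tail ?_
        rcases o with _ | pd
        · simp [guess] at heq
        · by_cases hl : pd ∈ M.δ q' (tapeAt x j) ∧ q' ∉ M.rej
          · simp only [guess, if_pos hl, Prod.mk.injEq, Sum.inl.injEq] at heq
            exact ⟨fun h => h.elim hq hl.2, pd, hl.1, by rw [heq.1, heq.2]⟩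
          · simp [guess, hl] at heq
    · rw [TwoPFA.next, if_pos (inr_mem_halting b), PMF.mem_support_pure_iff] at h
      simp at h

/-- The simulation follows every computation path of the 2nfa with positive probability. -/
theorem exists_dist_ne_zero {c : M.State × Cell x}
    (h : Relation.ReflTransGen (M.Step x) (M.start, 0) c) :
    ∃ t, M.toTwoPFA.dist x t (.inl c.1, c.2) ≠ 0 := by
  induction h with
  | refl =>
    refine ⟨0, ?_⟩
    rw [← PMF.mem_support_iff, TwoPFA.dist, PMF.mem_support_pure_iff]
  | @tail b c _ hbc ih =>
    obtain ⟨t, ht⟩ := ih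
    obtain ⟨hb, pd, hpd, rfl⟩ := hbc
    refine ⟨t + 1, ?_⟩
    rw [← PMF.mem_support_iff, TwoPFA.dist, PMF.mem_support_bind_iff]
    refine ⟨_, ht, ?_⟩
    rw [TwoPFA.next, if_neg fun h => hb (Or.inl (inl_mem_halting.1 h)), PMF.mem_support_map_iff]
    refine ⟨(.inl pd.1, pd.2), ?_, rfl⟩
    rw [PMF.mem_support_map_iff]
    refine ⟨(some pd, true), PMF.mem_support_uniformOfFintype _, ?_⟩
    rw [guess, if_pos ⟨hpd, fun h => hb (Or.inr h)⟩]

/-- Without accepting paths the `simAcc` term of `distExp_total` vanishes; as the running mass tends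
to `0`, the negative verdict alone tends to `1 / 2`. -/
theorem half_le_rejProb_toTwoPFA (h : M.Rejects x) : 1 / 2 ≤ M.toTwoPFA.rejProb x := by
  have hzero : ∀ t, M.toTwoPFA.distExp x t ((M.simAcc x).indicator 1) = 0 := by
    intro t
    rw [TwoPFA.distExp, ENNReal.tsum_eq_zero]
    rintro ⟨q | b, i⟩
    · by_cases hq : q ∈ M.acc
      · rw [mul_eq_zero]
        left
        by_contra hne
        exact h ⟨_, reflTransGen_of_dist_ne_zero t hne, hq⟩
      · rw [Set.indicator_of_notMem (inl_mem_simAcc.not.2 hq), mul_zero]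
    · rw [Set.indicator_of_notMem inr_notMem_simAcc, mul_zero]
  have hle : ∀ t, 1 ≤ 2 * M.toTwoPFA.rejProb x +
      M.toTwoPFA.distExp x t ((M.running x).indicator 1) := by
    intro t
    rw [← distExp_total (M := M) (x := x) t, hzero t, add_zero]
    gcongr
    rw [← distExp_rej]
    exact TwoPFA.distExp_indicator_le_rejProb t
  have hlim := ge_of_tendsto' (tendsto_const_nhds.add tendsto_distExp_running) hle
  rw [add_zero, mul_comm] at hlim
  exact ENNReal.div_le_of_le_mul hlim

/-- The mass of `simAcc` becomes positive and never decreases, while the running mass tends to `0`.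
Once the former exceeds the latter, `distExp_total` puts acceptance strictly above `1 / 2`. -/
theorem half_lt_accProb_toTwoPFA (h : M.Accepts x) : 1 / 2 < M.toTwoPFA.accProb x := by
  obtain ⟨c, hc, hacc⟩ := h
  obtain ⟨t₀, ht₀⟩ := exists_dist_ne_zero hc
  have hpos : M.toTwoPFA.distExp x t₀ ((M.simAcc x).indicator 1) ≠ 0 := by
    rw [TwoPFA.distExp, Ne, ENNReal.tsum_eq_zero]
    intro h
    have := h (.inl c.1, c.2)
    rw [Set.indicator_of_mem (inl_mem_simAcc.2 hacc), Pi.one_apply, mul_one] at this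
    exact ht₀ this
  have hmono : Monotone fun t => M.toTwoPFA.distExp x t ((M.simAcc x).indicator 1) := by
    refine monotone_nat_of_le_succ fun t => TwoPFA.distExp_le_succ ?_ t
    rintro ⟨q | b, i⟩ hq
    · exact Set.indicator_of_notMem (fun h => hq (inl_mem_halting.2 (inl_mem_simAcc.1 h))) _
    · exact Set.indicator_of_notMem inr_notMem_simAcc _
  obtain ⟨t, hlt, ht⟩ := ((tendsto_distExp_running (M := M) (x := x)).eventually
    (gt_mem_nhds (pos_iff_ne_zero.2 hpos))).and (Filter.eventually_ge_atTop t₀) |>.exists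
  set r := M.toTwoPFA.distExp x t ((M.running x).indicator 1)
  have hr : r ≠ ⊤ := (hlt.trans_le le_top).ne
  have hacc' := distExp_acc (M := M) (x := x) t
  have htot := distExp_total (M := M) (x := x) t
  rw [distExp_verdict_eq] at hacc'
  set v := M.toTwoPFA.distExp x t ((M.verdict x false).indicator 1)
  set s := M.toTwoPFA.distExp x t ((M.simAcc x).indicator 1)
  have hs : r < s := hlt.trans_le (hmono ht)
  refine lt_of_lt_of_le ?_ (TwoPFA.distExp_indicator_le_accProb t)
  rw [hacc']
  refine ENNReal.div_lt_of_lt_mul ?_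
  rw [← htot]
  calc 2 * v + s + r < 2 * v + s + s := by
        refine ENNReal.add_lt_add_left ?_ hs
        exact ne_top_of_le_ne_top ENNReal.one_ne_top (htot ▸ le_self_add)
    _ = (v + s) * 2 := by ring

theorem card_state_toTwoPFA : Fintype.card M.toTwoPFA.State = Fintype.card M.State + 2 := by
  have : Fintype.card (M.State ⊕ Bool) = Fintype.card M.State + 2 := by simp
  exact this

end TwoNFA

theorem Class2N_subset_Class2P : Class2N ⊆ Class2P := by
  rintro L ⟨M, p, hp, h⟩
  refine ⟨fun n => (M n).toTwoPFA, p + 2, fun n => ?_, fun n =>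
    ⟨fun x hx => TwoNFA.half_lt_accProb_toTwoPFA ((h n).1 x hx),
      fun x hx => TwoNFA.half_le_rejProb_toTwoPFA ((h n).2 x hx)⟩⟩
  rw [TwoNFA.card_state_toTwoPFA]
  simpa using hp n

/-! ### A family in `2BP` that is not in `2N` -/

instance TapeSymbol.finite {A : Type} [Finite A] : Finite (TapeSymbol A) := by
  refine Finite.of_surjective
    (fun o : Option (Option A) => o.elim leftEnd fun o => o.elim rightEnd letter) ?_
  rintro (_ | a | _)
  · exact ⟨none, rfl⟩
  · exact ⟨some (some a), rfl⟩
  · exact ⟨some none, rfl⟩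

/-! ### Counting the languages of small 2nfa's -/

namespace TwoNFA

variable {A : Type}

/-- Renaming the states of a 2nfa. -/
abbrev rename (M : TwoNFA A) {S : Type} [Fintype S] (e : M.State ≃ S) : TwoNFA A where
  State := S
  δ q σ := {pd | (e.symm pd.1, pd.2) ∈ M.δ (e.symm q) σ}
  start := e M.start
  acc := e.symm ⁻¹' M.acc
  rej := e.symm ⁻¹' M.rej
  disjoint := M.disjoint.preimage _

theorem accepts_rename (M : TwoNFA A) {S : Type} [Fintype S] (e : M.State ≃ S) (x : List A) :
    (M.rename e).Accepts x ↔ M.Accepts x := by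
  constructor
  · rintro ⟨c, hc, hacc⟩
    refine ⟨(e.symm c.1, c.2), ?_, hacc⟩
    have hstep : ∀ a b : S × Cell x, (M.rename e).Step x a b →
        M.Step x (e.symm a.1, a.2) (e.symm b.1, b.2) := by
      rintro a b ⟨ha, pd, hpd, rfl⟩
      exact ⟨ha, _, hpd, rfl⟩
    have hpath := Relation.ReflTransGen.lift _ hstep _ _ hc
    simpa [Function.onFun] using hpath
  · rintro ⟨c, hc, hacc⟩
    refine ⟨(e c.1, c.2), ?_, ?_⟩
    · refine hc.lift (p := (M.rename e).Step x) (fun c => (e c.1, c.2)) ?_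
      rintro a b ⟨ha, pd, hpd, rfl⟩
      refine ⟨?_, (e pd.1, pd.2), ?_, rfl⟩
      · simpa [TwoNFA.rename] using ha
      · simpa [TwoNFA.rename] using hpd
    · simpa using hacc

/-- The language accepted by a 2nfa. -/
def language (M : TwoNFA A) : Set (List A) := {x | M.Accepts x}

/-- Up to equivalence there are finitely many 2nfa's of bounded size. -/
theorem finite_language [Finite A] (s : ℕ) :
    {l | ∃ M : TwoNFA A, Fintype.card M.State ≤ s ∧ M.language = l}.Finite := by
  -- With the state set normalised to `Fin k`, only finitely many transition tables remain over a
  -- finite alphabet.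
  let Code := Σ k : Fin (s + 1), (Fin k → TapeSymbol A → Set (Fin k × SignType)) × Fin k ×
    {h : Set (Fin k) × Set (Fin k) // Disjoint h.1 h.2}
  let decode : Code → TwoNFA A := fun ⟨k, δ, q, h⟩ => ⟨Fin k, δ, q, h.1.1, h.1.2, h.2⟩
  refine (Set.finite_range fun c : Code => (decode c).language).subset ?_
  rintro _ ⟨M, hM, rfl⟩
  let e := Fintype.equivFin M.State
  let N := M.rename e
  refine ⟨⟨⟨Fintype.card M.State, Nat.lt_succ_of_le hM⟩, N.δ, N.start, ⟨(N.acc, N.rej),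
    N.disjoint⟩⟩, ?_⟩
  ext x
  exact accepts_rename M e x

/-- The acceptance of all short unary words and the rejection of all words that are at least three
times longer than the `i`-th threshold `3 ^ i`. -/
def SolvesThreshold (M : TwoNFA Unit) (i : ℕ) : Prop :=
  (∀ x : List Unit, x.length ≤ 3 ^ i → M.Accepts x) ∧
    ∀ x : List Unit, 3 ^ (i + 1) ≤ x.length → M.Rejects x

/-- One language cannot solve two threshold problems, so small 2nfa's solve finitely many. -/
theorem exists_threshold_not_solved (s : ℕ) :
    ∃ i, ∀ M : TwoNFA Unit, Fintype.card M.State ≤ s → ¬ M.SolvesThreshold i := by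
  by_contra! h
  choose M hM hsol using h
  have hne : ∀ i j, i < j → (M i).language ≠ (M j).language := by
    intro i j hij heq
    -- The word of length `3 ^ (i + 1)` separates the thresholds: it is too long for `i` and still
    -- short for every larger `j`.
    have hj : List.replicate (3 ^ (i + 1)) () ∈ (M j).language :=
      (hsol j).1 _ (by simpa using Nat.pow_le_pow_right three_pos hij)
    rw [← heq] at hj
    exact (hsol i).2 _ (by simp) hj
  have hinj : Function.Injective fun i => (M i).language := by
    intro i j heq
    rcases lt_trichotomy i j with hlt | rfl | hlt
    · exact absurd heq (hne i j hlt)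
    · rfl
    · exact absurd heq.symm (hne j i hlt)
  exact Set.infinite_range_of_injective hinj ((finite_language s).subset
    (Set.range_subset_iff.2 fun i => ⟨M i, hM i, rfl⟩))

end TwoNFA

/-! ### Threshold problems and their three-state probabilistic automata -/

/-- The family of threshold problems on unary words with the thresholds `3 ^ f n`. -/
def thresholdFamily (f : ℕ → ℕ) : PromiseFamily where
  Alphabet := Unit
  pos n := {x | x.length ≤ 3 ^ f n}
  neg n := {x | 3 ^ (f n + 1) ≤ x.length}
  disjoint n := by
    rw [Set.disjoint_left]
    intro x (hx : x.length ≤ 3 ^ f n) (hx' : 3 ^ (f n + 1) ≤ x.length)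
    exact absurd (hx'.trans hx) (Nat.pow_lt_pow_right (by norm_num) (Nat.lt_succ_self _)).not_ge

/-- A coin that shows `true` with probability `r`. -/
noncomputable def biasedCoin (r : ℝ≥0∞) (hr : r ≤ 1) : PMF Bool :=
  PMF.ofFintype (fun b => cond b r (1 - r)) (by simp [hr])

/-- The one-way automaton that survives each letter with probability `r` and accepts when it
reaches the right endmarker. The state `none` scans the input, and `some b` is a verdict. -/
noncomputable abbrev thresholdPFA (r : ℝ≥0∞) (hr : r ≤ 1) : TwoPFA Unit where
  State := Option Bool
  δ _ σ := match σ with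
    | .leftEnd => PMF.pure (none, 1)
    | .letter _ => (biasedCoin r hr).map fun b => if b then (none, 1) else (some false, 0)
    | .rightEnd => PMF.pure (some true, 0)
  start := none
  acc := {some true}
  rej := {some false}
  disjoint := by simp

section Threshold

variable {r : ℝ≥0∞} {hr : r ≤ 1} {x : List Unit}

theorem tapeAt_zero {A : Type} (x : List A) : tapeAt x 0 = .leftEnd := by
  simp [tapeAt]

theorem tapeAt_succ_of_lt {A : Type} {x : List A} {j : ℕ} (hj : j < x.length) :
    tapeAt x ((j + 1 : ℕ) : Cell x) = .letter x[j] := by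
  have hval : ((j + 1 : ℕ) : Cell x).val = j + 1 := ZMod.val_natCast_of_lt (by omega)
  rw [tapeAt, if_neg (by omega), hval]
  simp [hj]

theorem tapeAt_length_succ {A : Type} (x : List A) :
    tapeAt x ((x.length + 1 : ℕ) : Cell x) = .rightEnd := by
  have hval : ((x.length + 1 : ℕ) : Cell x).val = x.length + 1 :=
    ZMod.val_natCast_of_lt (by omega)
  rw [tapeAt, if_neg (by omega), hval]
  simp

theorem thresholdPFA_none_notMem :
    (none : Option Bool) ∉ (thresholdPFA r hr).acc ∪ (thresholdPFA r hr).rej := by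
  simp

theorem thresholdPFA_some_mem (b : Bool) :
    (some b : Option Bool) ∈ (thresholdPFA r hr).acc ∪ (thresholdPFA r hr).rej := by
  cases b <;> simp

theorem moveHead_natCast_one {A : Type} {x : List A} (j : ℕ) :
    moveHead ((j : ℕ) : Cell x) 1 = ((j + 1 : ℕ) : Cell x) := by
  simp [moveHead]

theorem nextExp_thresholdPFA_leftEnd (F : Option Bool × Cell x → ℝ≥0∞) :
    (thresholdPFA r hr).nextExp x F (none, 0) = F (none, ((1 : ℕ) : Cell x)) := by
  have hmove : moveHead (0 : Cell x) 1 = ((1 : ℕ) : Cell x) := by simp [moveHead]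
  rw [TwoPFA.nextExp_of_not_halting (M := thresholdPFA r hr) F thresholdPFA_none_notMem,
    tapeAt_zero, tsum_eq_single (none, 1)]
  · simp [hmove]
  · intro b hb
    simp [hb]

theorem nextExp_thresholdPFA_letter (F : Option Bool × Cell x → ℝ≥0∞) {j : ℕ}
    (hj : j < x.length) :
    (thresholdPFA r hr).nextExp x F (none, ((j + 1 : ℕ) : Cell x)) =
      r * F (none, ((j + 2 : ℕ) : Cell x)) +
        (1 - r) * F (some false, ((j + 1 : ℕ) : Cell x)) := by
  rw [TwoPFA.nextExp_of_not_halting (M := thresholdPFA r hr) F thresholdPFA_none_notMem,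
    tapeAt_succ_of_lt hj]
  refine (PMF.tsum_map_mul (biasedCoin r hr)
    (fun b => if b then ((none : Option Bool), (1 : SignType)) else (some false, 0))
    (fun pd => F (pd.1, moveHead ((j + 1 : ℕ) : Cell x) pd.2))).trans ?_
  rw [tsum_fintype, Fintype.sum_bool]
  simp only [if_true, Bool.false_eq_true, if_false, moveHead_natCast_one]
  simp [biasedCoin, moveHead, add_assoc, one_add_one_eq_two]

theorem nextExp_thresholdPFA_rightEnd (F : Option Bool × Cell x → ℝ≥0∞) :
    (thresholdPFA r hr).nextExp x F (none, ((x.length + 1 : ℕ) : Cell x)) =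
      F (some true, ((x.length + 1 : ℕ) : Cell x)) := by
  rw [TwoPFA.nextExp_of_not_halting (M := thresholdPFA r hr) F thresholdPFA_none_notMem,
    tapeAt_length_succ, tsum_eq_single (some true, 0)]
  · simp [moveHead]
  · intro b hb
    simp [hb]

/-- The probability of surviving the first `j` letters. -/
theorem pow_le_distExp_thresholdPFA (j : ℕ) : j ≤ x.length → ∀ F : Option Bool × Cell x → ℝ≥0∞,
    r ^ j * F (none, ((j + 1 : ℕ) : Cell x)) ≤ (thresholdPFA r hr).distExp x (j + 1) F := by
  induction j with
  | zero =>
    intro _ F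
    rw [TwoPFA.distExp_succ, TwoPFA.distExp_zero, nextExp_thresholdPFA_leftEnd]
    simp
  | succ j ih =>
    intro hj F
    rw [TwoPFA.distExp_succ]
    refine le_trans ?_ (ih (by omega) _)
    rw [nextExp_thresholdPFA_letter F hj, pow_succ, mul_assoc]
    gcongr
    exact le_self_add

theorem pow_length_le_accProb_thresholdPFA :
    r ^ x.length ≤ (thresholdPFA r hr).accProb x := by
  -- One step leaves the left endmarker, one is spent on each letter, and one more accepts at the
  -- right endmarker.
  refine le_trans ?_ (TwoPFA.distExp_indicator_le_accProb (x.length + 2))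
  rw [TwoPFA.distExp_succ]
  refine le_trans ?_ (pow_le_distExp_thresholdPFA x.length le_rfl _)
  rw [nextExp_thresholdPFA_rightEnd, Set.indicator_of_mem (by simp)]
  simp

/-- After `j` letters the automaton has either survived, with probability `r ^ j`, or rejected. In
each step the loss of survival probability is transferred to rejection. -/
theorem one_le_pow_add_distExp_thresholdPFA (j : ℕ) : j ≤ x.length →
    1 ≤ r ^ j + (thresholdPFA r hr).distExp x (j + 1)
      ({c | c.1 ∈ (thresholdPFA r hr).rej}.indicator 1) := by
  classical
  set R : Option Bool × Cell x → ℝ≥0∞ := {c | c.1 ∈ (thresholdPFA r hr).rej}.indicator 1 with hR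
  induction j with
  | zero => intro _; simp
  | succ j ih =>
    intro hj
    -- `P` records the chance of rejecting at the next letter; its expectation is at least `r ^ j *
    -- (1 - r)`, which is `r ^ j - r ^ (j + 1)`.
    let P : Option Bool × Cell x → ℝ≥0∞ := Pi.single (none, ((j + 1 : ℕ) : Cell x)) (1 - r)
    have hstep : R + P ≤ (thresholdPFA r hr).nextExp x R := by
      rintro ⟨q | b, i⟩
      · have hzero : R (none, i) = 0 := Set.indicator_of_notMem (by simp) _
        rw [Pi.add_apply, hzero, zero_add]
        by_cases hi : i = ((j + 1 : ℕ) : Cell x)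
        · rw [hi, nextExp_thresholdPFA_letter R hj,
            show R (some false, ((j + 1 : ℕ) : Cell x)) = 1 from Set.indicator_of_mem (by simp) _]
          simp [P]
        · rw [show P (none, i) = 0 from Pi.single_eq_of_ne (by simpa using hi) _]
          exact zero_le
      · rw [Pi.add_apply, show P (some b, i) = 0 from Pi.single_eq_of_ne (by simp) _, add_zero,
          TwoPFA.nextExp_of_halting (M := thresholdPFA r hr) R (thresholdPFA_some_mem b)]
    have hP : r ^ j * (1 - r) ≤ (thresholdPFA r hr).distExp x (j + 1) P := by
      refine le_trans (le_of_eq ?_) (pow_le_distExp_thresholdPFA j (by omega) P)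
      simp [P]
    calc 1 ≤ r ^ j + (thresholdPFA r hr).distExp x (j + 1) R := ih (by omega)
      _ = r ^ j * (r + (1 - r)) + (thresholdPFA r hr).distExp x (j + 1) R := by
        rw [add_tsub_cancel_of_le hr, mul_one]
      _ = r ^ (j + 1) + ((thresholdPFA r hr).distExp x (j + 1) R + r ^ j * (1 - r)) := by ring
      _ ≤ r ^ (j + 1) + (thresholdPFA r hr).distExp x (j + 2) R := by
        rw [TwoPFA.distExp_succ (j + 1)]
        gcongr
        refine le_trans ?_ (TwoPFA.distExp_mono (j + 1) hstep)
        rw [TwoPFA.distExp_add]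
        gcongr

theorem one_le_pow_length_add_rejProb_thresholdPFA :
    1 ≤ r ^ x.length + (thresholdPFA r hr).rejProb x :=
  (one_le_pow_add_distExp_thresholdPFA x.length le_rfl).trans <| by
    gcongr
    exact TwoPFA.distExp_indicator_le_rejProb _

end Threshold

/-- A survival probability under which words up to length `T` are accepted with probability at least
`2 / 3` and words of length at least `3 * T` with probability at most `1 / 3`. -/
theorem exists_survival_probability {T : ℕ} (hT : T ≠ 0) :
    ∃ r : ℝ≥0∞, r ≤ 1 ∧ (∀ k ≤ T, ENNReal.ofReal (2 / 3) ≤ r ^ k) ∧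
      ∀ k, T * 3 ≤ k → r ^ k ≤ ENNReal.ofReal (1 / 3) := by
  -- The `T`-th root of `2 / 3` makes survival of `T` letters have probability exactly `2 / 3`; for
  -- `3 * T` letters it is `8 / 27`, below `1 / 3`. Hence the factor `3` between the two lengths.
  set s : ℝ := (2 / 3 : ℝ) ^ ((T : ℝ)⁻¹)
  have hs : s ^ T = 2 / 3 := Real.rpow_inv_natCast_pow (by norm_num) hT
  have hs0 : 0 ≤ s := by positivity
  have hs1 : s ≤ 1 := Real.rpow_le_one (by norm_num) (by norm_num) (by positivity)
  refine ⟨ENNReal.ofReal s, by simpa using hs1, fun k hk => ?_, fun k hk => ?_⟩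
  · rw [← ENNReal.ofReal_pow hs0]
    exact ENNReal.ofReal_le_ofReal (hs ▸ pow_le_pow_of_le_one hs0 hs1 hk)
  · rw [← ENNReal.ofReal_pow hs0]
    refine ENNReal.ofReal_le_ofReal ((pow_le_pow_of_le_one hs0 hs1 hk).trans ?_)
    rw [pow_mul, hs]
    norm_num

theorem thresholdFamily_mem_Class2BP (f : ℕ → ℕ) : thresholdFamily f ∈ Class2BP := by
  choose r hr hpos hneg using fun n =>
    exists_survival_probability (T := 3 ^ f n) (pow_ne_zero _ three_ne_zero)
  -- The polynomial is the constant `3`: the threshold enters only through the real number `r n`,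
  -- never through the number of states.
  refine ⟨fun n => thresholdPFA (r n) (hr n), 3, fun n => ?_, 1 / 3, by norm_num, by norm_num,
    fun n => ⟨fun x hx => ?_, fun x hx => ?_⟩⟩
  · simp
  · rw [show (1 - 1 / 3 : ℝ) = 2 / 3 by norm_num]
    exact (hpos n _ hx).trans pow_length_le_accProb_thresholdPFA
  · have hx' : 3 ^ f n * 3 ≤ x.length := (pow_succ 3 (f n)).symm.le.trans hx
    have h := (one_le_pow_length_add_rejProb_thresholdPFA (hr := hr n) (x := x)).trans
      (add_le_add_left (hneg n _ hx') _)
    rw [ENNReal.ofReal_sub _ (by norm_num), ENNReal.ofReal_one]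
    exact tsub_le_iff_left.2 h

/-- Every polynomial is eventually below `2 ^ n`. -/
theorem Polynomial.exists_eval_le_two_pow (p : Polynomial ℕ) : ∃ n, p.eval n ≤ 2 ^ n := by
  have h : (fun n : ℕ => ((p.eval n : ℕ) : ℝ)) =o[Filter.atTop] fun n : ℕ => (2 : ℝ) ^ n := by
    induction p using Polynomial.induction_on' with
    | add p q hp hq => simpa using hp.add hq
    | monomial k a =>
      simpa using (isLittleO_pow_const_const_pow_of_one_lt k one_lt_two).const_mul_left (a : ℝ)
  obtain ⟨n, hn⟩ := (h.bound one_pos).exists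
  refine ⟨n, ?_⟩
  rw [one_mul, Real.norm_natCast, norm_pow, Real.norm_ofNat] at hn
  exact_mod_cast hn

/-- The exponent `f n` is chosen against all 2nfa's with at most `2 ^ n` states, so a family with
polynomially many states fails at any `n` where its polynomial is at most `2 ^ n`. -/
theorem not_Class2BP_subset_Class2N : ¬ Class2BP ⊆ Class2N := by
  intro h
  choose f hf using fun n : ℕ => TwoNFA.exists_threshold_not_solved (2 ^ n)
  obtain ⟨M, p, hp, hM⟩ := h (thresholdFamily_mem_Class2BP f)
  obtain ⟨n, hn⟩ := p.exists_eval_le_two_pow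
  exact hf n (M n) ((hp n).trans hn) ⟨fun x hx => (hM n).1 x hx, fun x hx => (hM n).2 x hx⟩

theorem Class2D_ssubset_Class2BP : Class2D ⊂ Class2BP :=
  ⟨Class2D_subset_Class2BP, fun h =>
    not_Class2BP_subset_Class2N (h.trans Class2D_subset_Class2N)⟩

theorem lemma4 :
    (Class2D ⊂ Class2BP ∧ ¬ Class2BP ⊆ Class2N) ∧
    Class2BP ⊆ Class2BQ ∧
    Class2BQ ⊆ Class2Q ∧
    Class2N ⊆ Class2P ∧
    Class2P ⊆ Class2Q :=
  ⟨⟨Class2D_ssubset_Class2BP, not_Class2BP_subset_Class2N⟩, Class2BP_subset_Class2BQ,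
    Class2BQ_subset_Class2Q, Class2N_subset_Class2P, Class2P_subset_Class2Q⟩
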